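/- Let $\Delta$ be a finitely generated group which is co-Hopfian (every subgroup $H\le\Delta$ with $H\cong\Delta$ equals $\Delta$) and has no free cyclic factor (there are no subgroup $A\le\Delta$ and infinite cyclic subgroup $\langle t\rangle\le\Delta$ such that $\Delta$ is the free product $A*\langle t\rangle$). Then the free product $\Gamma=\Delta*\mathbb{Z}$ has Property FSL. Here, for a finite symmetric generating set $S$ of a finitely generated group $G$ with word norm $\|\cdot\|$, the stable norm of $g\in G$ is $\|g\|_\infty=\lim_{n\to\infty}\|g^n\|/n$. A finitely generated group $G$ has Property FSL if, for every finite symmetric generating set $S$ of $G$ and every real $D>1$, the set of automorphisms $\psi\in\mathrm{Aut}(G)$ such that $\|\psi(g)\|_\infty\le D\,\|g\|_\infty$ for all $g\in G$ has finite image in $\mathrm{Out}(G)=\mathrm{Aut}(G)/\mathrm{Inn}(G)$. -/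

import Mathlib

namespace StableNorm

open Filter Topology

/-- `S` is a finite symmetric generating set of the group `G`. -/
structure IsFiniteSymmGenSet {G : Type*} [Group G] (S : Set G) : Prop where
  finite : S.Finite
  inv_mem : ∀ s ∈ S, s⁻¹ ∈ S
  closure_eq_top : Subgroup.closure S = ⊤

/-- The word norm of `g` with respect to `S`: the least length of a word in the letters `S`
whose product is `g`. -/
noncomputable def wordNorm {G : Type*} [Group G] (S : Set G) (g : G) : ℕ :=
  sInf {n : ℕ | ∃ l : List G, l.length = n ∧ (∀ x ∈ l, x ∈ S) ∧ l.prod = g}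

/-- The stable norm `lim ‖g ^ n‖ / n` of `g` with respect to `S`. The limit exists whenever `S` is
a finite symmetric generating set, see `tendsto_stableNorm`. -/
noncomputable def stableNorm {G : Type*} [Group G] (S : Set G) (g : G) : ℝ :=
  limUnder atTop (fun n : ℕ => (wordNorm S (g ^ n) : ℝ) / n)

theorem exists_word {G : Type*} [Group G] {S : Set G} (hS : IsFiniteSymmGenSet S) (g : G) :
    ∃ l : List G, l.length = wordNorm S g ∧ (∀ x ∈ l, x ∈ S) ∧ l.prod = g := by
  have hne : {n : ℕ | ∃ l : List G, l.length = n ∧ (∀ x ∈ l, x ∈ S) ∧ l.prod = g}.Nonempty := by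
    have hg : g ∈ (Subgroup.closure S).toSubmonoid := by rw [hS.closure_eq_top]; trivial
    rw [Subgroup.closure_toSubmonoid] at hg
    obtain ⟨l, hl, hp⟩ := Submonoid.exists_list_of_mem_closure hg
    refine ⟨l.length, l, rfl, fun x hx => ?_, hp⟩
    rcases hl x hx with h | h
    · exact h
    · simpa using hS.inv_mem _ h
  exact Nat.sInf_mem hne

theorem wordNorm_mul_le {G : Type*} [Group G] {S : Set G} (hS : IsFiniteSymmGenSet S) (g h : G) :
    wordNorm S (g * h) ≤ wordNorm S g + wordNorm S h := by
  obtain ⟨l, hl, hlS, hlp⟩ := exists_word hS g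
  obtain ⟨m, hm, hmS, hmp⟩ := exists_word hS h
  refine Nat.sInf_le ⟨l ++ m, by simp [hl, hm], fun x hx => ?_, by simp [hlp, hmp]⟩
  rcases List.mem_append.1 hx with h | h
  · exact hlS x h
  · exact hmS x h

theorem tendsto_stableNorm {G : Type*} [Group G] {S : Set G} (hS : IsFiniteSymmGenSet S) (g : G) :
    Tendsto (fun n : ℕ => (wordNorm S (g ^ n) : ℝ) / n) atTop (𝓝 (stableNorm S g)) := by
  have hsub : Subadditive (fun n : ℕ => (wordNorm S (g ^ n) : ℝ)) := by
    intro m n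
    simp only [pow_add]
    exact_mod_cast wordNorm_mul_le hS (g ^ m) (g ^ n)
  have hbdd : BddBelow (Set.range fun n : ℕ => (wordNorm S (g ^ n) : ℝ) / n) := by
    refine ⟨0, ?_⟩
    rintro _ ⟨n, rfl⟩
    positivity
  exact tendsto_nhds_limUnder ⟨_, hsub.tendsto_lim hbdd⟩

/-- The automorphisms of `G` that are `D`-Lipschitz for the stable norm with respect to `S`. -/
def lipschitzAut {G : Type*} [Group G] (S : Set G) (D : ℝ) : Set (MulAut G) :=
  {ψ | ∀ g : G, stableNorm S (ψ g) ≤ D * stableNorm S g}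

/-- The inner automorphisms of `G`. -/
def Inn (G : Type*) [Group G] : Subgroup (MulAut G) := (MulAut.conj : G →* MulAut G).range

instance instNormalInn (G : Type*) [Group G] : (Inn G).Normal := by
  constructor
  rintro _ ⟨g, rfl⟩ ψ
  refine ⟨ψ g, ?_⟩
  ext x
  simp [MulAut.mul_apply]

/-- The outer automorphism group `Out G = Aut G / Inn G`. -/
abbrev Out (G : Type*) [Group G] : Type _ := MulAut G ⧸ Inn G

/-- Property FSL: `G` is finitely generated and, for the stable norm of any finite symmetric
generating set and any `D > 1`, the `D`-Lipschitz automorphisms represent only finitely many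
elements of `Out G`. -/
def HasFSL (G : Type*) [Group G] : Prop :=
  Group.FG G ∧ ∀ S : Set G, IsFiniteSymmGenSet S → ∀ D : ℝ, 1 < D →
    ((QuotientGroup.mk : MulAut G → Out G) '' lipschitzAut S D).Finite

/-- `G` is co-Hopfian: a subgroup isomorphic to `G` is all of `G`. -/
def IsCoHopfian (G : Type*) [Group G] : Prop :=
  ∀ H : Subgroup G, Nonempty (H ≃* G) → H = ⊤

/-- `G` has a free cyclic factor: it is the internal free product of a subgroup `A` and an
infinite cyclic subgroup, generated by `t`. -/
def HasFreeCyclicFactor (G : Type*) [Group G] : Prop :=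
  ∃ (A : Subgroup G) (t : G),
    Function.Bijective (Monoid.Coprod.lift A.subtype (zpowersHom G t))

end StableNorm

/-! Elements of `Δ * ⟨t⟩` are uniquely represented by reduced words (Britton), and everything is
read off from such words.

The rigidity input is that an embedded copy `H` of a co-Hopfian group is conjugate into `Δ`
(`exists_conj_range_le`). Otherwise some conjugate of `H` contains a cyclically reduced element `h`
starting with `t` or its inverse. After inverting and conjugating, `h` starts with `t`. Replacing
`t` by `h * t` whenever the prefix before it lies in `H` then defines an injective endomorphism of
`H` whose image misses `h`, because every affected word becomes longer than `h`.

So, modulo inner automorphisms, an automorphism `ψ` restricts to some `α : Δ → Δ` and sends `t` to a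
reduced word `L * t ^ v * d` starting with a power of `t` (`exists_conj_normalForm`). Then `t * g`
goes to `L * t ^ v * (d * α g)`, which has reduced powers as soon as `d * α g ≠ 1`. Without
cancellation in powers, word length is bounded by a multiple of the stable norm
(`exists_wordLength_le_mul_stableNorm`). Applying the Lipschitz condition to `t * g` for finitely
many `g` therefore bounds `L`, `d` and `d * α g`, which leaves finitely many images of the
generators. -/

namespace StableNorm

open Monoid Monoid.Coprod Filter Topology

/-! ### Reduced words in `Δ * ℤ` -/

section Words

variable {Δ : Type*} [Group Δ]

/-- The generator of the infinite cyclic factor of `Δ * ℤ`. -/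
def stableLetter (Δ : Type*) [Group Δ] : Coprod Δ (Multiplicative ℤ) :=
  inr (Multiplicative.ofAdd 1)

/-- The element of `Δ * ℤ` represented by a list of pairs `(u, g)`, each standing for `t ^ u * g`. -/
def wordProd (L : List (ℤˣ × Δ)) : Coprod Δ (Multiplicative ℤ) :=
  (L.map fun p => stableLetter Δ ^ (p.1 : ℤ) * inl p.2).prod

/-- A word is reduced if it has no subword `t ^ u * 1 * t ^ (-u)`. -/
def Reduced (L : List (ℤˣ × Δ)) : Prop :=
  L.IsChain fun p q => p.2 = 1 → p.1 = q.1

@[simp]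
theorem wordProd_nil : wordProd ([] : List (ℤˣ × Δ)) = 1 := rfl

@[simp]
theorem wordProd_cons (u : ℤˣ) (a : Δ) (L : List (ℤˣ × Δ)) :
    wordProd ((u, a) :: L) = stableLetter Δ ^ (u : ℤ) * inl a * wordProd L := by
  simp [wordProd]

@[simp]
theorem wordProd_append (L L' : List (ℤˣ × Δ)) :
    wordProd (L ++ L') = wordProd L * wordProd L' := by
  simp [wordProd]

/-- The HNN extension of `Δ` over trivial subgroups, a model of `Δ * ℤ`. -/
abbrev trivialHNN (Δ : Type*) [Group Δ] : Type _ :=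
  HNNExtension Δ (⊥ : Subgroup Δ) (⊥ : Subgroup Δ) (MulEquiv.refl _)

/-- The comparison map from `Δ * ℤ` to the HNN extension over trivial subgroups. -/
noncomputable def toTrivialHNN (Δ : Type*) [Group Δ] :
    Coprod Δ (Multiplicative ℤ) →* trivialHNN Δ :=
  Coprod.lift HNNExtension.of (zpowersHom _ HNNExtension.t)

theorem toTrivialHNN_wordProd (a : Δ) (L : List (ℤˣ × Δ)) :
    toTrivialHNN Δ (inl a * wordProd L) =
      HNNExtension.of a * (L.map fun p => HNNExtension.t ^ (p.1 : ℤ) * HNNExtension.of p.2).prod := by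
  have : ∀ L : List (ℤˣ × Δ), toTrivialHNN Δ (wordProd L) =
      (L.map fun p => HNNExtension.t ^ (p.1 : ℤ) * HNNExtension.of p.2).prod := by
    intro L
    induction L with
    | nil => simp
    | cons p L ih =>
      obtain ⟨u, b⟩ := p
      rw [wordProd_cons, map_mul, ih]
      simp [toTrivialHNN, stableLetter]
  rw [map_mul, this]
  simp [toTrivialHNN]

/-- Britton's lemma for `Δ * ℤ`: reduced words are determined by the element they represent. -/
theorem reduced_unique {a a' : Δ} {L L' : List (ℤˣ × Δ)} (hL : Reduced L) (hL' : Reduced L')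
    (h : (inl a * wordProd L : Coprod Δ (Multiplicative ℤ)) = inl a' * wordProd L') :
    a = a' ∧ L = L' := by
  have htop : ∀ u : ℤˣ, HNNExtension.toSubgroup (⊥ : Subgroup Δ) ⊥ u = ⊥ := by
    intro u; rcases Int.units_eq_one_or u with rfl | rfl <;> simp
  -- Over trivial subgroups all of `Δ` is a transversal, so normal words are exactly the reduced
  -- ones.
  let d : HNNExtension.NormalWord.TransversalPair Δ (⊥ : Subgroup Δ) ⊥ :=
    ⟨fun _ => Set.univ, fun u => by rw [htop]; exact Subgroup.isComplement_singleton_left.2 rfl⟩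
  have hch : ∀ {L : List (ℤˣ × Δ)}, Reduced L → L.IsChain fun p q =>
      p.2 ∈ HNNExtension.toSubgroup (⊥ : Subgroup Δ) ⊥ p.1 → p.1 = q.1 := by
    intro L hL
    refine List.IsChain.imp (fun p q hpq hp => hpq ?_) hL
    rwa [htop, Subgroup.mem_bot] at hp
  let w : HNNExtension.NormalWord d := ⟨⟨a, L, hch hL⟩, fun _ _ _ => Set.mem_univ _⟩
  let w' : HNNExtension.NormalWord d := ⟨⟨a', L', hch hL'⟩, fun _ _ _ => Set.mem_univ _⟩
  have hw : w.prod (MulEquiv.refl _) = w'.prod (MulEquiv.refl _) := by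
    have := congrArg (toTrivialHNN Δ) h
    rwa [toTrivialHNN_wordProd, toTrivialHNN_wordProd] at this
  have := HNNExtension.NormalWord.prod_injective (MulEquiv.refl _) d hw
  exact ⟨congrArg (fun w => w.head) this, congrArg (fun w => w.toList) this⟩

theorem Reduced.tail {p : ℤˣ × Δ} {L : List (ℤˣ × Δ)} (h : Reduced (p :: L)) : Reduced L :=
  (List.isChain_cons.1 h).2

theorem reduced_cons_cons {p q : ℤˣ × Δ} {L : List (ℤˣ × Δ)} :
    Reduced (p :: q :: L) ↔ (p.2 = 1 → p.1 = q.1) ∧ Reduced (q :: L) :=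
  List.isChain_cons_cons

theorem reduced_append {L L' : List (ℤˣ × Δ)} :
    Reduced (L ++ L') ↔ Reduced L ∧ Reduced L' ∧
      ∀ p ∈ L.getLast?, ∀ q ∈ L'.head?, p.2 = 1 → p.1 = q.1 :=
  List.isChain_append

@[simp]
theorem reduced_singleton (p : ℤˣ × Δ) : Reduced [p] := List.isChain_singleton p

theorem reduced_concat_iff (L : List (ℤˣ × Δ)) (v : ℤˣ) (b c : Δ) :
    Reduced (L ++ [(v, b)]) ↔ Reduced (L ++ [(v, c)]) := by
  simp only [reduced_append]
  simp

/-- Reducedness ignores the last coefficient of a word, so two words can be glued along a common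
letter `t ^ v`. -/
theorem reduced_append_cons_iff (L L' : List (ℤˣ × Δ)) (v : ℤˣ) (b c : Δ) :
    Reduced (L ++ (v, b) :: L') ↔ Reduced (L ++ [(v, c)]) ∧ Reduced ((v, b) :: L') := by
  simp only [reduced_append]
  constructor
  · rintro ⟨h1, h2, h3⟩
    exact ⟨⟨h1, reduced_singleton _, by simpa using h3⟩, h2⟩
  · rintro ⟨⟨h1, -, h3⟩, h2⟩
    exact ⟨h1, h2, by simpa using h3⟩

theorem wordProd_concat_mul (L : List (ℤˣ × Δ)) (v : ℤˣ) (b c : Δ) :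
    wordProd (L ++ [(v, b)]) * inl c = wordProd (L ++ [(v, b * c)]) := by
  simp [mul_assoc]

/-- The new letter is either prepended or cancels the first one; the final disjunction records
which, for later length estimates. -/
theorem exists_reduced_zpow_mul (u : ℤˣ) (a : Δ) (L : List (ℤˣ × Δ)) (hL : Reduced L) :
    ∃ b L', Reduced L' ∧ stableLetter Δ ^ (u : ℤ) * (inl a * wordProd L) = inl b * wordProd L' ∧
      ((b = 1 ∧ L' = (u, a) :: L) ∨ ∃ v, L = (v, b) :: L') := by
  rcases L with _ | ⟨⟨v, c⟩, L⟩
  · exact ⟨1, [(u, a)], reduced_singleton _, by simp, by simp⟩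
  · by_cases h : a = 1 → u = v
    · exact ⟨1, (u, a) :: (v, c) :: L, reduced_cons_cons.2 ⟨h, hL⟩, by simp [mul_assoc], by simp⟩
    · push Not at h
      obtain ⟨rfl, h⟩ := h
      refine ⟨c, L, hL.tail, ?_, by simp⟩
      have : (v : ℤ) = -u := by
        rcases Int.units_eq_one_or u with rfl | rfl <;> rcases Int.units_eq_one_or v with rfl | rfl <;>
          simp_all
      simp [this, mul_assoc]

/-- Every element of `Δ * ℤ` is represented by a reduced word. -/
theorem exists_reduced (γ : Coprod Δ (Multiplicative ℤ)) :
    ∃ a L, Reduced L ∧ γ = inl a * wordProd L := by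
  suffices H : ∀ γ δ : Coprod Δ (Multiplicative ℤ), (∃ a L, Reduced L ∧ δ = inl a * wordProd L) →
      ∃ a L, Reduced L ∧ γ * δ = inl a * wordProd L by
    simpa using H γ 1 ⟨1, [], List.isChain_nil, by simp⟩
  intro γ
  induction γ using Coprod.induction_on with
  | inl b =>
    rintro _ ⟨a, L, hL, rfl⟩
    exact ⟨b * a, L, hL, by simp [mul_assoc]⟩
  | inr n =>
    have hn : (inr n : Coprod Δ (Multiplicative ℤ)) = stableLetter Δ ^ (Multiplicative.toAdd n) := by
      rw [stableLetter, ← map_zpow, ← ofAdd_zsmul]; simp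
    rw [hn]
    generalize Multiplicative.toAdd n = n
    induction n with
    | zero => simp
    | succ n ih =>
      intro δ hδ
      obtain ⟨a, L, hL, hγ⟩ := ih δ hδ
      obtain ⟨b, L', hL', h, -⟩ := exists_reduced_zpow_mul 1 a L hL
      refine ⟨b, L', hL', ?_⟩
      rw [← h, ← hγ, ← mul_assoc, ← zpow_add]; simp [add_comm]
    | pred n ih =>
      intro δ hδ
      obtain ⟨a, L, hL, hγ⟩ := ih δ hδ
      obtain ⟨b, L', hL', h, -⟩ := exists_reduced_zpow_mul (-1) a L hL
      refine ⟨b, L', hL', ?_⟩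
      rw [← h, ← hγ, ← mul_assoc, ← zpow_add]; congr 2; push_cast; ring
  | mul x y hx hy =>
    intro δ hδ
    rw [mul_assoc]
    exact hx _ (hy _ hδ)

@[elab_as_elim]
theorem coprod_induction {P : Coprod Δ (Multiplicative ℤ) → Prop}
    (inl : ∀ a, P (inl a)) (stableLetter : P (stableLetter Δ))
    (mul : ∀ g g', P g → P g' → P (g * g')) (inv : ∀ g, P g → P g⁻¹)
    (g : Coprod Δ (Multiplicative ℤ)) : P g := by
  let K : Subgroup (Coprod Δ (Multiplicative ℤ)) :=
    { carrier := {g | P g}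
      one_mem' := by simpa using inl 1
      mul_mem' := fun {a b} ha hb => mul a b ha hb
      inv_mem' := fun {a} ha => inv a ha }
  have hK : ∀ a, P a ↔ a ∈ K := fun _ => Iff.rfl
  rw [hK]
  obtain ⟨a, L, -, rfl⟩ := exists_reduced g
  refine K.mul_mem (inl a) (Subgroup.list_prod_mem _ ?_)
  simp only [List.mem_map]
  rintro _ ⟨p, -, rfl⟩
  exact K.mul_mem (K.zpow_mem stableLetter _) (inl _)

end Words

/-! ### Cyclically reduced elements and inversion -/

section Cyclic

variable {Δ : Type*} [Group Δ]

/-- `g` is represented by a word `L` starting with `t ^ u` such that `L * t ^ u` is reduced. -/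
def IsCyclicallyReduced (u : ℤˣ) (g : Coprod Δ (Multiplicative ℤ)) : Prop :=
  ∃ a L, Reduced ((u, a) :: L ++ [(u, 1)]) ∧ g = wordProd ((u, a) :: L)

/-- The word both begins and ends with a power of `t`, so inversion merely reverses it and no
coefficient from `Δ` is left over at either end. -/
theorem exists_inv_wordProd (L : List (ℤˣ × Δ)) (u v : ℤˣ) (a : Δ)
    (h : Reduced ((v, a) :: L ++ [(u, 1)])) :
    ∃ b L', Reduced ((-u, b) :: L' ++ [(-v, 1)]) ∧
      (wordProd ((v, a) :: L ++ [(u, 1)]))⁻¹ = wordProd ((-u, b) :: L' ++ [(-v, 1)]) := by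
  induction L generalizing v a with
  | nil =>
    refine ⟨a⁻¹, [], ?_, ?_⟩
    · simp only [List.cons_append, List.nil_append, reduced_cons_cons, reduced_singleton,
        and_true] at h ⊢
      intro ha
      rw [h (inv_eq_one.1 ha)]
    · simp [mul_assoc]
  | cons p L ih =>
    obtain ⟨w, c⟩ := p
    obtain ⟨b, L', hL', hinv⟩ := ih w c h.tail
    refine ⟨b, L' ++ [(-w, a⁻¹)], ?_, ?_⟩
    · have h1 := (reduced_cons_cons.1 h).1
      rw [List.cons_append, List.append_assoc, ← List.cons_append, List.singleton_append,
        reduced_append_cons_iff _ _ _ _ 1]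
      refine ⟨hL', reduced_cons_cons.2 ⟨fun ha => ?_, reduced_singleton _⟩⟩
      exact congrArg Neg.neg (h1 (inv_eq_one.1 ha)).symm
    · have : wordProd ((v, a) :: (w, c) :: L ++ [(u, 1)]) =
          stableLetter Δ ^ (v : ℤ) * inl a * wordProd ((w, c) :: L ++ [(u, 1)]) :=
        wordProd_cons _ _ _
      rw [this, mul_inv_rev, hinv]
      simp [mul_assoc]

/-- The inverse of `g` ends with `t ^ (-u)`; the conjugation moves this letter to the front. -/
theorem IsCyclicallyReduced.neg {u : ℤˣ} {g : Coprod Δ (Multiplicative ℤ)}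
    (h : IsCyclicallyReduced u g) :
    IsCyclicallyReduced (-u) (stableLetter Δ ^ (-u : ℤ) * g⁻¹ * stableLetter Δ ^ (u : ℤ)) := by
  obtain ⟨a, L, hL, rfl⟩ := h
  obtain ⟨b, L', hL', h⟩ := exists_inv_wordProd L u u a hL
  refine ⟨b, L', hL', ?_⟩
  simp only [wordProd_append, wordProd_cons, wordProd_nil, map_one, mul_one, mul_inv_rev,
    List.cons_append, Units.val_neg, zpow_neg] at h ⊢
  rw [← mul_assoc] at h
  rw [← mul_assoc, ← mul_assoc, h]
  simp [mul_assoc]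

end Cyclic

/-! ### The twisting cocycle of a subgroup -/

section Twist

variable {Δ : Type*} [Group Δ]

/-- Right translation action on functions `Γ → Γ`. -/
def rightTranslate (Γ : Type*) [Group Γ] : Γ →* MulAut (Γ → Γ) where
  toFun g :=
    { toFun := fun f x => f (x * g)
      invFun := fun f x => f (x * g⁻¹)
      left_inv := fun f => by ext; simp
      right_inv := fun f => by ext; simp
      map_mul' := fun _ _ => rfl }
  map_one' := by ext; simp
  map_mul' g g' := by ext; simp [mul_assoc]

variable (H : Subgroup (Coprod Δ (Multiplicative ℤ)))
  (h : Coprod Δ (Multiplicative ℤ))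

open Classical in
/-- The lift of `Δ * ℤ` to an unrestricted wreath product that replaces the letter `t` by `h * t`
whenever the prefix in front of it lies in `H`. -/
noncomputable def twistHom : Coprod Δ (Multiplicative ℤ) →*
    (Coprod Δ (Multiplicative ℤ) → Coprod Δ (Multiplicative ℤ)) ⋊[rightTranslate _]
      Coprod Δ (Multiplicative ℤ) :=
  Coprod.lift
    { toFun := fun a => ⟨fun _ => inl a, inl a⟩
      map_one' := SemidirectProduct.ext (funext fun _ => map_one inl) (map_one inl)
      map_mul' := fun a b =>
        SemidirectProduct.ext (funext fun _ => map_mul inl a b) (map_mul inl a b) }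
    (zpowersHom _ ⟨fun x => if x ∈ H then h * stableLetter Δ else stableLetter Δ, stableLetter Δ⟩)

/-- The element obtained from `g` by twisting, when `g` is read starting from `x`. -/
noncomputable def twist (x g : Coprod Δ (Multiplicative ℤ)) : Coprod Δ (Multiplicative ℤ) :=
  (twistHom H h g).left x

theorem twistHom_right (g : Coprod Δ (Multiplicative ℤ)) : (twistHom H h g).right = g := by
  suffices SemidirectProduct.rightHom.comp (twistHom H h) = MonoidHom.id _ from
    DFunLike.congr_fun this g
  refine Coprod.hom_ext ?_ ?_
  · ext a; simp [twistHom]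
  · ext; simp [twistHom, stableLetter]

@[simp]
theorem twist_one (x : Coprod Δ (Multiplicative ℤ)) : twist H h x 1 = 1 := by
  simp [twist]

theorem twist_mul (x g g' : Coprod Δ (Multiplicative ℤ)) :
    twist H h x (g * g') = twist H h x g * twist H h (x * g) g' := by
  simp only [twist, map_mul, SemidirectProduct.mul_left, twistHom_right]
  rfl

@[simp]
theorem twist_inl (x : Coprod Δ (Multiplicative ℤ)) (a : Δ) : twist H h x (inl a) = inl a := by
  simp [twist, twistHom]

theorem twist_stableLetter_of_mem {x : Coprod Δ (Multiplicative ℤ)} (hx : x ∈ H) :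
    twist H h x (stableLetter Δ) = h * stableLetter Δ := by
  simp [twist, twistHom, stableLetter, hx]

theorem twist_stableLetter_of_notMem {x : Coprod Δ (Multiplicative ℤ)} (hx : x ∉ H) :
    twist H h x (stableLetter Δ) = stableLetter Δ := by
  simp [twist, twistHom, stableLetter, hx]

theorem twist_inv (x g : Coprod Δ (Multiplicative ℤ)) :
    twist H h x g⁻¹ = (twist H h (x * g⁻¹) g)⁻¹ := by
  rw [eq_inv_iff_mul_eq_one, ← twist_mul]; simp

/-- Replacing `t` by `h * t` after a prefix `x ∈ H` changes the running product by the factor `x * h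
* x⁻¹ ∈ H`, so its coset is unchanged. At `x = 1` this shows that twisting preserves `H`. -/
theorem twist_mem {h : Coprod Δ (Multiplicative ℤ)} (hh : h ∈ H)
    (g x : Coprod Δ (Multiplicative ℤ)) : x * twist H h x g * (x * g)⁻¹ ∈ H := by
  induction g using coprod_induction generalizing x with
  | inl a => simp
  | stableLetter =>
    by_cases hx : x ∈ H
    · rw [twist_stableLetter_of_mem H h hx]
      have := H.mul_mem (H.mul_mem hx hh) (H.inv_mem hx)
      simpa [mul_assoc] using this
    · rw [twist_stableLetter_of_notMem H h hx]
      simp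
  | mul g g' hg hg' =>
    have := H.mul_mem (hg x) (hg' (x * g))
    simpa [twist_mul, mul_assoc] using this
  | inv g hg =>
    have := H.inv_mem (hg (x * g⁻¹))
    simpa [twist_inv, mul_assoc] using this

/-- Only the coset `H * x` is tested when a letter is read. With the cocycle rule `twist_mul`, this
makes `twist H h 1` multiplicative on `H`. -/
theorem twist_mul_left {k : Coprod Δ (Multiplicative ℤ)} (hk : k ∈ H)
    (g x : Coprod Δ (Multiplicative ℤ)) : twist H h (k * x) g = twist H h x g := by
  induction g using coprod_induction generalizing x with
  | inl a => simp
  | stableLetter =>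
    by_cases hx : x ∈ H
    · rw [twist_stableLetter_of_mem H h hx, twist_stableLetter_of_mem H h (H.mul_mem hk hx)]
    · rw [twist_stableLetter_of_notMem H h hx,
        twist_stableLetter_of_notMem H h (mt (H.mul_mem_cancel_left hk).1 hx)]
  | mul y z hy hz => rw [twist_mul, twist_mul, hy, mul_assoc, hz]
  | inv y hy => rw [twist_inv, twist_inv, mul_assoc, hy]

end Twist

/-! ### Twisting produces a proper self-embedding -/

section TwistReduced

variable {Δ : Type*} [Group Δ] (H : Subgroup (Coprod Δ (Multiplicative ℤ)))

/-- Twisting by a cyclically reduced element maps a reduced word to a reduced word with the same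
initial sign; it lengthens the word if the first letter is affected. -/
theorem exists_reduced_twist {c : Δ} {M : List (ℤˣ × Δ)} (hM : Reduced ((1, c) :: M ++ [(1, 1)]))
    (L : List (ℤˣ × Δ)) (u : ℤˣ) (a : Δ) (hL : Reduced ((u, a) :: L))
    (x : Coprod Δ (Multiplicative ℤ)) :
    ∃ b L', Reduced ((u, b) :: L') ∧
      twist H (wordProd ((1, c) :: M)) x (wordProd ((u, a) :: L)) = wordProd ((u, b) :: L') ∧
      (u = 1 → x ∈ H → M.length + 1 < ((u, b) :: L').length) := by
  set h := wordProd ((1, c) :: M) with hh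
  -- Each letter `t ^ u` becomes a reduced word that begins and ends with `t ^ u`: the letter
  -- itself, `h * t`, or the inverse of `h * t`. Substitution therefore creates no cancellation.
  have hletter : ∀ (u : ℤˣ) (x : Coprod Δ (Multiplicative ℤ)), ∃ (L' : List (ℤˣ × Δ)),
      Reduced (L' ++ [(u, 1)]) ∧ twist H h x (stableLetter Δ ^ (u : ℤ)) = wordProd (L' ++ [(u, 1)]) ∧
      (∀ p ∈ (L' ++ [(u, 1)]).head?, p.1 = u) ∧ (u = 1 → x ∈ H → M.length + 1 ≤ L'.length) := by
    intro u x
    rcases Int.units_eq_one_or u with rfl | rfl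
    · by_cases hx : x ∈ H
      · refine ⟨(1, c) :: M, hM, ?_, by simp, by simp⟩
        rw [Units.val_one, zpow_one, twist_stableLetter_of_mem H h hx, wordProd_append, ← hh]
        simp
      · refine ⟨[], by simp, ?_, by simp, fun _ h => absurd h hx⟩
        rw [Units.val_one, zpow_one, twist_stableLetter_of_notMem H h hx]
        simp
    · have hinv : stableLetter Δ ^ ((-1 : ℤˣ) : ℤ) = (stableLetter Δ)⁻¹ := by simp
      rw [hinv, twist_inv]
      by_cases hx : x * (stableLetter Δ)⁻¹ ∈ H
      · obtain ⟨b, L', hL', hinv⟩ := exists_inv_wordProd M 1 1 c hM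
        refine ⟨(-1, b) :: L', hL', ?_, by simp, by simp⟩
        rw [twist_stableLetter_of_mem H h hx, ← hinv, wordProd_append, ← hh]
        simp
      · refine ⟨[], by simp, ?_, by simp, by simp⟩
        rw [twist_stableLetter_of_notMem H h hx]
        simp
  have hstep : ∀ (N L' : List (ℤˣ × Δ)) (u : ℤˣ) (a : Δ), Reduced (N ++ [(u, 1)]) →
      (∀ p ∈ (N ++ [(u, 1)]).head?, p.1 = u) → Reduced ((u, a) :: L') →
      ∃ b L'', Reduced ((u, b) :: L'') ∧
        wordProd (N ++ [(u, 1)]) * (inl a * wordProd L') = wordProd ((u, b) :: L'') ∧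
        N.length + 1 ≤ ((u, b) :: L'').length := by
    intro N L' u a h1 h2 h3
    have hred : Reduced (N ++ (u, a) :: L') := (reduced_append_cons_iff _ _ _ _ 1).2 ⟨h1, h3⟩
    have hprod : wordProd (N ++ [(u, 1)]) * (inl a * wordProd L') =
        wordProd (N ++ (u, a) :: L') := by simp [mul_assoc]
    rcases N with _ | ⟨⟨v, b⟩, N⟩
    · exact ⟨a, L', hred, hprod, by simp⟩
    · obtain rfl : v = u := by simpa using h2
      exact ⟨b, N ++ (v, a) :: L', hred, hprod, by simp⟩
  induction L generalizing u a x with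
  | nil =>
    obtain ⟨N, hN, htw, hhead, hlen⟩ := hletter u x
    obtain ⟨b, L'', h1, h2, h3⟩ := hstep N [] u a hN hhead (reduced_singleton _)
    refine ⟨b, L'', h1, ?_, fun hu hx => (Nat.lt_succ_of_le (hlen hu hx)).trans_le h3⟩
    rw [wordProd_cons, twist_mul, twist_mul, twist_inl, htw, ← h2]
    simp
  | cons p L ih =>
    obtain ⟨v, c'⟩ := p
    obtain ⟨N, hN, htw, hhead, hlen⟩ := hletter u x
    obtain ⟨b', L', hL', htw', -⟩ := ih v c' hL.tail (x * (stableLetter Δ ^ (u : ℤ) * inl a))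
    obtain ⟨b, L'', h1, h2, h3⟩ := hstep N ((v, b') :: L') u a hN hhead
      (reduced_cons_cons.2 ⟨(reduced_cons_cons.1 hL).1, hL'⟩)
    refine ⟨b, L'', h1, ?_, fun hu hx => (Nat.lt_succ_of_le (hlen hu hx)).trans_le h3⟩
    rw [wordProd_cons, twist_mul, twist_mul, twist_inl, htw, ← h2, htw', mul_assoc]

/-- A subgroup of `Δ * ℤ` containing an element which is cyclically reduced starting with `t` is
isomorphic to a proper subgroup of itself. -/
theorem not_isCyclicallyReduced_one {K : Type*} [Group K]
    (hK : ∀ θ : K →* K, Function.Injective θ → Function.Surjective θ)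
    (j : K →* Coprod Δ (Multiplicative ℤ)) (hj : Function.Injective j) (k : K) :
    ¬ IsCyclicallyReduced 1 (j k) := by
  rintro ⟨c, M, hM, hk⟩
  have hkH : wordProd ((1, c) :: M) ∈ j.range := ⟨k, hk⟩
  have htw : ∀ y : K, ∃ z : K, j z = twist j.range (wordProd ((1, c) :: M)) 1 (j y) := by
    intro y
    have h1 := twist_mem j.range hkH (j y) 1
    rw [one_mul, one_mul] at h1
    exact (j.range.mul_mem_cancel_right (j.range.inv_mem ⟨y, rfl⟩)).1 h1
  choose θ hθ using htw
  let Θ : K →* K := MonoidHom.mk' θ fun y z => hj <| by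
    rw [map_mul, hθ, hθ, hθ, map_mul, twist_mul, one_mul]
    congr 1
    simpa using twist_mul_left j.range (wordProd ((1, c) :: M)) (k := j y) ⟨y, rfl⟩ (j z) 1
  -- Twisting keeps the head coefficient and the first sign. Hence a word containing a letter `t ^
  -- u` never becomes trivial, which gives injectivity.
  have hform : ∀ y, (∃ a, j y = inl a ∧ j (θ y) = inl a) ∨ ∃ a u b L b' L', Reduced ((u, b') :: L') ∧
      j y = inl a * wordProd ((u, b) :: L) ∧ j (θ y) = inl a * wordProd ((u, b') :: L') ∧
      (u = 1 → inl a ∈ j.range → M.length + 1 < ((u, b') :: L').length) := by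
    intro y
    obtain ⟨a, L, hL, h⟩ := exists_reduced (j y)
    rcases L with _ | ⟨⟨u, b⟩, L⟩
    · refine Or.inl ⟨a, by simpa using h, ?_⟩
      rw [hθ, h]
      simp
    · obtain ⟨b', L', h1, h2, h3⟩ := exists_reduced_twist j.range hM L u b hL (inl a)
      refine Or.inr ⟨a, u, b, L, b', L', h1, h, ?_, h3⟩
      rw [hθ, h, twist_mul, twist_inl, one_mul, h2]
  have hinj : Function.Injective Θ := by
    rw [injective_iff_map_eq_one]
    intro y hy
    have hy : θ y = 1 := hy
    rcases hform y with ⟨a, h1, h2⟩ | ⟨a, u, b, L, b', L', h1, -, h3, -⟩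
    · rw [← h1.trans h2.symm |> hj.eq_iff.1] at hy
      exact hy
    · rw [hy, map_one] at h3
      have := reduced_unique (a := 1) (L := []) List.isChain_nil h1 (by simpa using h3)
      simp at this
  -- A preimage `y` of `h` would also start with `t`, with trivial prefix, which lies in the range
  -- of `j`; its image would then be strictly longer than `h`.
  obtain ⟨y, hy⟩ := hK Θ hinj k
  have hy : θ y = k := hy
  have hred : Reduced ((1, c) :: M) := (reduced_append.1 hM).1
  rcases hform y with ⟨a, -, h2⟩ | ⟨a, u, b, L, b', L', h1, -, h3, h4⟩
  · rw [hy, hk] at h2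
    have := reduced_unique (a := 1) (a' := a) (L' := []) hred List.isChain_nil (by simpa using h2)
    simp at this
  · rw [hy, hk] at h3
    obtain ⟨ha, h⟩ := reduced_unique (a := 1) (a' := a) hred h1 (by rwa [map_one, one_mul])
    have h5 := h4 (by simp_all) (by simp [← ha])
    rw [← h] at h5
    simp at h5

theorem not_isCyclicallyReduced {K : Type*} [Group K]
    (hK : ∀ θ : K →* K, Function.Injective θ → Function.Surjective θ)
    (j : K →* Coprod Δ (Multiplicative ℤ)) (hj : Function.Injective j) (u : ℤˣ) (k : K) :
    ¬ IsCyclicallyReduced u (j k) := by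
  rcases Int.units_eq_one_or u with rfl | rfl
  · exact not_isCyclicallyReduced_one hK j hj k
  · intro h
    refine not_isCyclicallyReduced_one hK ((MulAut.conj (stableLetter Δ)).toMonoidHom.comp j)
      ((MulEquiv.injective (MulAut.conj (stableLetter Δ))).comp hj) k⁻¹ ?_
    simpa using h.neg

end TwistReduced

/-! ### Co-Hopfian subgroups are conjugate into `Δ` -/

section Conjugation

variable {Δ : Type*} [Group Δ]

/-- Every element of `Δ * ℤ` is conjugate into `Δ` or to a cyclically reduced element. -/
theorem exists_conj_mem_or_isCyclicallyReduced (n : ℕ) (a : Δ) (L : List (ℤˣ × Δ))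
    (hL : Reduced L) (hn : L.length ≤ n) :
    ∃ x : Coprod Δ (Multiplicative ℤ), (∃ b, MulAut.conj x (inl a * wordProd L) = inl b) ∨
      ∃ u, IsCyclicallyReduced u (MulAut.conj x (inl a * wordProd L)) := by
  induction n generalizing a L with
  | zero =>
    obtain rfl : L = [] := by simpa using hn
    exact ⟨1, Or.inl ⟨a, by simp⟩⟩
  | succ n ih =>
    rcases L with _ | ⟨⟨u, b⟩, L⟩
    · exact ⟨1, Or.inl ⟨a, by simp⟩⟩
    rcases List.eq_nil_or_concat' L with rfl | ⟨L, ⟨v, d⟩, rfl⟩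
    · refine ⟨(inl a)⁻¹, Or.inr ⟨u, b * a, [], ?_, by simp [mul_assoc]⟩⟩
      simp [reduced_cons_cons]
    by_cases hvd : d * a = 1 → v = u
    · refine ⟨(inl a)⁻¹, Or.inr ⟨u, b, L ++ [(v, d * a)], ?_, by simp [mul_assoc]⟩⟩
      rw [List.cons_append, List.append_assoc, ← List.cons_append, List.singleton_append,
        reduced_append_cons_iff _ _ _ _ d]
      exact ⟨hL, reduced_cons_cons.2 ⟨hvd, reduced_singleton _⟩⟩
    -- The word is `a * t ^ u * b ⋯ t ^ (-u) * d` with `d * a = 1`, so conjugation cancels its two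
    -- outer letters.
    · push Not at hvd
      obtain ⟨hd, hvu⟩ := hvd
      have hvu : (v : ℤ) = -u := by
        rcases Int.units_eq_one_or u with rfl | rfl <;> rcases Int.units_eq_one_or v with rfl | rfl <;>
          simp_all
      have hconj : MulAut.conj (stableLetter Δ ^ (v : ℤ) * (inl a)⁻¹)
          (inl a * wordProd ((u, b) :: (L ++ [(v, d)]))) = inl b * wordProd L := by
        have : (inl d : Coprod Δ (Multiplicative ℤ)) * inl a = 1 := by rw [← map_mul, hd, map_one]
        rw [MulAut.conj_apply]
        simp only [wordProd_cons, wordProd_append, wordProd_nil, hvu, mul_inv_rev, zpow_neg,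
          inv_inv, mul_one, mul_assoc, inv_mul_cancel_left]
        rw [← mul_assoc (inl d), this]
        simp
      obtain ⟨x, hx⟩ := ih b L ((reduced_append.1 hL.tail).1) (by simp at hn; omega)
      refine ⟨x * (stableLetter Δ ^ (v : ℤ) * (inl a)⁻¹), ?_⟩
      rwa [map_mul MulAut.conj, MulAut.mul_apply, hconj]

/-- A co-Hopfian subgroup of `Δ * ℤ` is conjugate into `Δ`. -/
theorem exists_conj_range_le {K : Type*} [Group K]
    (hK : ∀ θ : K →* K, Function.Injective θ → Function.Surjective θ)
    (j : K →* Coprod Δ (Multiplicative ℤ)) (hj : Function.Injective j) :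
    ∃ x, ∀ k, ∃ a : Δ, MulAut.conj x (j k) = inl a := by
  have hnot : ∀ x u k, ¬ IsCyclicallyReduced u (MulAut.conj x (j k)) := fun x u k =>
    not_isCyclicallyReduced hK ((MulAut.conj x).toMonoidHom.comp j)
      ((MulEquiv.injective (MulAut.conj x)).comp hj) u k
  by_cases htriv : ∀ k : K, k = 1
  · exact ⟨1, fun k => ⟨1, by simp [htriv k]⟩⟩
  push Not at htriv
  obtain ⟨k₀, hk₀⟩ := htriv
  obtain ⟨a₀, L₀, hL₀, h₀⟩ := exists_reduced (j k₀)
  obtain ⟨x, ⟨b, hb⟩ | ⟨u, hu⟩⟩ := exists_conj_mem_or_isCyclicallyReduced _ a₀ L₀ hL₀ le_rfl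
  swap
  · rw [← h₀] at hu
    exact absurd hu (hnot _ _ _)
  rw [← h₀] at hb
  have hb1 : b ≠ 1 := by
    rintro rfl
    rw [map_one, map_eq_one_iff _ (MulEquiv.injective _), map_eq_one_iff _ hj] at hb
    exact hk₀ hb
  -- The conjugator `x` found for the single element `k₀ ≠ 1` works for every `k`: in Bass–Serre
  -- terms, edge stabilisers are trivial, so a nontrivial element fixes at most one vertex.
  refine ⟨x, fun k => ?_⟩
  obtain ⟨a, L, hL, h⟩ := exists_reduced (MulAut.conj x (j k))
  rcases L with _ | ⟨⟨u, c⟩, L⟩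
  · exact ⟨a, by simpa using h⟩
  exfalso
  have hmul : ∀ y : K, MulAut.conj ((inl a)⁻¹ * x) (j (k * y)) =
      wordProd ((u, c) :: L) * MulAut.conj x (j y) * inl a := by
    intro y
    rw [map_mul j, map_mul, map_mul MulAut.conj, MulAut.mul_apply, MulAut.mul_apply, h]
    simp [mul_assoc]
  rcases List.eq_nil_or_concat' L with rfl | ⟨L, ⟨v, d⟩, rfl⟩
  · refine hnot ((inl a)⁻¹ * x) u (k * 1) ⟨c * a, [], ?_, ?_⟩
    · simp [reduced_cons_cons]
    · rw [hmul]; simp [mul_assoc]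
  · have key : ∀ e : Δ, (e = 1 → v = u) →
        IsCyclicallyReduced u (wordProd ((u, c) :: L ++ [(v, e)])) := by
      intro e he
      refine ⟨c, L ++ [(v, e)], ?_, rfl⟩
      rw [List.cons_append, List.append_assoc, ← List.cons_append, List.singleton_append,
        reduced_append_cons_iff _ _ _ _ d]
      exact ⟨hL, reduced_cons_cons.2 ⟨he, reduced_singleton _⟩⟩
    by_cases hda : d * a = 1
    -- Here `k` itself may fail to be cyclically reduced. Multiplying by `k₀` turns the last
    -- coefficient into `d * b * a = a⁻¹ * b * a ≠ 1`, which prevents cancellation.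
    · refine hnot ((inl a)⁻¹ * x) u (k * k₀) ?_
      rw [hmul, hb]
      have := key (d * b * a) fun he => absurd ?_ hb1
      · convert this using 1
        simp [mul_assoc]
      · rw [eq_inv_of_mul_eq_one_left hda] at he
        simpa [mul_assoc, inv_mul_eq_one, eq_comm] using he
    · refine hnot ((inl a)⁻¹ * x) u (k * 1) ?_
      rw [hmul]
      have := key (d * a) (fun h => absurd h hda)
      convert this using 1
      simp [mul_assoc]

end Conjugation

/-! ### Stable norm estimates and finiteness -/

section WordNorm

variable {G : Type*} [Group G] {S : Set G}

theorem wordNorm_one : wordNorm S (1 : G) = 0 :=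
  Nat.sInf_eq_zero.2 (Or.inl ⟨[], rfl, by simp, by simp⟩)

theorem wordNorm_pow_le (hS : IsFiniteSymmGenSet S) (g : G) (n : ℕ) :
    wordNorm S (g ^ n) ≤ n * wordNorm S g := by
  induction n with
  | zero => simp [wordNorm_one]
  | succ n ih =>
    rw [pow_succ, Nat.succ_mul]
    exact (wordNorm_mul_le hS _ _).trans (Nat.add_le_add_right ih _)

theorem stableNorm_le_wordNorm (hS : IsFiniteSymmGenSet S) (g : G) :
    stableNorm S g ≤ wordNorm S g := by
  refine le_of_tendsto (tendsto_stableNorm hS g) ?_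
  filter_upwards [eventually_gt_atTop 0] with n hn
  rw [div_le_iff₀ (by exact_mod_cast hn), mul_comm]
  exact_mod_cast wordNorm_pow_le hS g n

theorem stableNorm_conj_le (hS : IsFiniteSymmGenSet S) (x g : G) :
    stableNorm S (MulAut.conj x g) ≤ stableNorm S g := by
  have h0 : Tendsto (fun n : ℕ => ((wordNorm S x + wordNorm S x⁻¹ : ℕ) : ℝ) / n) atTop (𝓝 0) :=
    tendsto_const_div_atTop_nhds_zero_nat _
  refine le_of_tendsto_of_tendsto' (tendsto_stableNorm hS _)
    (by simpa using (tendsto_stableNorm hS g).add h0) fun n => ?_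
  rw [← add_div, ← map_pow, MulAut.conj_apply]
  refine div_le_div_of_nonneg_right ?_ (Nat.cast_nonneg n)
  have h1 := wordNorm_mul_le hS (x * g ^ n) x⁻¹
  have h2 := wordNorm_mul_le hS x (g ^ n)
  exact_mod_cast (by omega : wordNorm S (x * g ^ n * x⁻¹) ≤
    wordNorm S (g ^ n) + (wordNorm S x + wordNorm S x⁻¹))

theorem finite_lists_of_length_le {α : Type*} {E : Set α} (hE : E.Finite) (n : ℕ) :
    {l : List α | l.length ≤ n ∧ ∀ x ∈ l, x ∈ E}.Finite := by
  have := hE.to_subtype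
  refine ((List.finite_length_le E n).image (List.map Subtype.val)).subset ?_
  rintro l ⟨hl, hE⟩
  lift l to List E using hE
  exact ⟨l, by simpa using hl, rfl⟩

theorem finite_wordNorm_le (hS : IsFiniteSymmGenSet S) (n : ℕ) : {g | wordNorm S g ≤ n}.Finite := by
  refine ((finite_lists_of_length_le hS.finite n).image List.prod).subset fun g hg => ?_
  obtain ⟨l, hl, hlS, rfl⟩ := exists_word hS g
  exact ⟨l, ⟨hl.trans_le hg, hlS⟩, rfl⟩

theorem exists_isFiniteSymmGenSet (hG : Group.FG G) : ∃ S : Set G, IsFiniteSymmGenSet S := by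
  obtain ⟨S, hS, hfin⟩ := Group.fg_iff.1 hG
  refine ⟨S ∪ S⁻¹, hfin.union hfin.inv, fun s hs => ?_, ?_⟩
  · simpa [or_comm] using hs
  · rw [← top_le_iff, ← hS]
    exact Subgroup.closure_mono Set.subset_union_left

theorem finite_mulAut_of_mem (hfin : S.Finite) (hS : Subgroup.closure S = ⊤) {E : Set G}
    (hE : E.Finite) : {ψ : MulAut G | ∀ s ∈ S, ψ s ∈ E}.Finite := by
  have := hfin.to_subtype
  refine Set.Finite.of_injOn (f := fun ψ : MulAut G => fun s : S => ψ s)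
    (t := Set.univ.pi fun _ => E) (fun ψ hψ s _ => hψ s s.2) ?_ (Set.Finite.pi fun _ => hE)
  intro ψ _ φ _ h
  have : (ψ : G →* G) = φ :=
    MonoidHom.eq_of_eqOn_dense hS fun s hs => congrFun h ⟨s, hs⟩
  exact MulEquiv.ext fun g => DFunLike.congr_fun this g

theorem IsCoHopfian.surjective (hG : IsCoHopfian G) (θ : G →* G) (hθ : Function.Injective θ) :
    Function.Surjective θ :=
  MonoidHom.range_eq_top.1 (hG θ.range ⟨(MonoidHom.ofInjective hθ).symm⟩)

end WordNorm

/-! ### Length of reduced words versus stable norm -/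

section Length

variable {Δ : Type*} [Group Δ] (S : Set Δ)

/-- The length of a word in the letters `t` and the elements of `Δ`, the latter being weighted by
their word norm. -/
noncomputable def wordLength (L : List (ℤˣ × Δ)) : ℕ :=
  (L.map fun p => wordNorm S p.2 + 1).sum

@[simp]
theorem wordLength_nil : wordLength S [] = 0 := rfl

@[simp]
theorem wordLength_cons (p : ℤˣ × Δ) (L : List (ℤˣ × Δ)) :
    wordLength S (p :: L) = wordNorm S p.2 + 1 + wordLength S L := by
  simp [wordLength]

@[simp]
theorem wordLength_append (L L' : List (ℤˣ × Δ)) :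
    wordLength S (L ++ L') = wordLength S L + wordLength S L' := by
  simp [wordLength]

theorem length_le_wordLength (L : List (ℤˣ × Δ)) : L.length ≤ wordLength S L := by
  induction L with
  | nil => simp
  | cons p L ih => simp; omega

theorem wordNorm_le_wordLength {p : ℤˣ × Δ} {L : List (ℤˣ × Δ)} (hp : p ∈ L) :
    wordNorm S p.2 ≤ wordLength S L :=
  (Nat.le_succ _).trans (List.single_le_sum (fun _ _ => Nat.zero_le _) _ (List.mem_map_of_mem hp))

/-- The length of the reduced word representing an element of `Δ * ℤ`. -/
noncomputable def reducedLength (γ : Coprod Δ (Multiplicative ℤ)) : ℕ :=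
  wordNorm S (exists_reduced γ).choose + wordLength S (exists_reduced γ).choose_spec.choose

theorem reducedLength_eq (a : Δ) {L : List (ℤˣ × Δ)} (hL : Reduced L) :
    reducedLength S (inl a * wordProd L) = wordNorm S a + wordLength S L := by
  have h := (exists_reduced (inl a * wordProd L)).choose_spec.choose_spec
  obtain ⟨h1, h2⟩ := reduced_unique hL h.1 h.2
  exact congrArg₂ (· + ·) (congrArg _ h1).symm (congrArg _ h2).symm

variable {S}

theorem reducedLength_inl_mul_le (hS : IsFiniteSymmGenSet S) (a : Δ) (γ : Coprod Δ (Multiplicative ℤ)) :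
    reducedLength S (inl a * γ) ≤ wordNorm S a + reducedLength S γ := by
  obtain ⟨b, L, hL, rfl⟩ := exists_reduced γ
  rw [← mul_assoc, ← map_mul, reducedLength_eq S _ hL, reducedLength_eq S _ hL, ← add_assoc]
  exact Nat.add_le_add_right (wordNorm_mul_le hS a b) _

theorem reducedLength_zpow_mul_le (u : ℤˣ) (γ : Coprod Δ (Multiplicative ℤ)) :
    reducedLength S (stableLetter Δ ^ (u : ℤ) * γ) ≤ 1 + reducedLength S γ := by
  obtain ⟨a, L, hL, rfl⟩ := exists_reduced γ
  obtain ⟨b, L', hL', h, ⟨rfl, rfl⟩ | ⟨v, rfl⟩⟩ := exists_reduced_zpow_mul u a L hL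
  · rw [h, reducedLength_eq S _ hL, reducedLength_eq S _ hL', wordNorm_one, wordLength_cons]
    dsimp only
    omega
  · rw [h, reducedLength_eq S _ hL, reducedLength_eq S _ hL', wordLength_cons]
    dsimp only
    omega

/-- The letters of `γ` are prepended to `δ` one at a time, each costing at most its own weight. -/
theorem reducedLength_mul_le (hS : IsFiniteSymmGenSet S) (γ δ : Coprod Δ (Multiplicative ℤ)) :
    reducedLength S (γ * δ) ≤ reducedLength S γ + reducedLength S δ := by
  have key : ∀ L : List (ℤˣ × Δ),
      reducedLength S (wordProd L * δ) ≤ wordLength S L + reducedLength S δ := by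
    intro L
    induction L with
    | nil => simp
    | cons p L ih =>
      obtain ⟨u, a⟩ := p
      have h1 := reducedLength_zpow_mul_le (S := S) u (inl a * (wordProd L * δ))
      have h2 := reducedLength_inl_mul_le hS a (wordProd L * δ)
      simp only [wordProd_cons, wordLength_cons, mul_assoc] at h1 h2 ⊢
      omega
  obtain ⟨a, L, hL, rfl⟩ := exists_reduced γ
  have h1 := reducedLength_inl_mul_le hS a (wordProd L * δ)
  have h2 := key L
  rw [reducedLength_eq S _ hL, mul_assoc]
  omega

theorem exists_reducedLength_le_mul_wordNorm (hS : IsFiniteSymmGenSet S)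
    {T : Set (Coprod Δ (Multiplicative ℤ))}
    (hT : IsFiniteSymmGenSet T) : ∃ M : ℕ, ∀ γ, reducedLength S γ ≤ M * wordNorm T γ := by
  -- `M` bounds the reduced length of the finitely many generators in `T`.
  obtain ⟨M, hM⟩ := (hT.finite.image (reducedLength S)).bddAbove
  refine ⟨M, fun γ => ?_⟩
  obtain ⟨l, hl, hlT, rfl⟩ := exists_word hT γ
  rw [← hl]
  clear hl
  induction l with
  | nil =>
    have := reducedLength_eq S 1 (L := []) List.isChain_nil
    simp_all [wordNorm_one]
  | cons s l ih =>
    have h1 := reducedLength_mul_le hS s l.prod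
    have h2 : reducedLength S s ≤ M := hM ⟨s, hlT s (by simp), rfl⟩
    have h3 := ih fun x hx => hlT x (by simp [hx])
    rw [List.prod_cons, List.length_cons, Nat.mul_succ]
    omega

theorem reduced_flatten_replicate {L : List (ℤˣ × Δ)} (hL : Reduced (L ++ L)) (n : ℕ) :
    Reduced (List.replicate n L).flatten := by
  induction n with
  | zero => exact List.isChain_nil
  | succ n ih =>
    rw [List.replicate_succ, List.flatten_cons, reduced_append]
    refine ⟨(reduced_append.1 hL).1, ih, fun p hp q hq => ?_⟩
    refine (reduced_append.1 hL).2.2 p hp q ?_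
    rcases n with _ | n
    · simp at hq
    · rcases L with _ | ⟨r, L⟩
      · simp at hp
      · simpa [List.replicate_succ] using hq

/-- The stable norm of a cyclically reduced element is bounded below by its length. -/
theorem exists_wordLength_le_mul_stableNorm (hS : IsFiniteSymmGenSet S)
    {T : Set (Coprod Δ (Multiplicative ℤ))}
    (hT : IsFiniteSymmGenSet T) : ∃ M : ℕ, ∀ L : List (ℤˣ × Δ), Reduced (L ++ L) →
      (wordLength S L : ℝ) ≤ M * stableNorm T (wordProd L) := by
  obtain ⟨M, hM⟩ := exists_reducedLength_le_mul_wordNorm hS hT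
  refine ⟨M, fun L hL => ?_⟩
  refine ge_of_tendsto ((tendsto_stableNorm hT (wordProd L)).const_mul (M : ℝ)) ?_
  filter_upwards [eventually_gt_atTop 0] with n hn
  -- Since `L ++ L` is reduced, so are all repetitions of `L`; the length of the `n`th power is
  -- exactly `n` times that of `L`.
  have hpow : ∀ n : ℕ, wordProd L ^ n = wordProd (List.replicate n L).flatten ∧
      wordLength S (List.replicate n L).flatten = n * wordLength S L := by
    intro n
    induction n with
    | zero => simp
    | succ n ih =>
      rw [List.replicate_succ, List.flatten_cons, wordProd_append, wordLength_append, pow_succ',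
        ih.1, ih.2, Nat.succ_mul, add_comm]
      exact ⟨rfl, rfl⟩
  have h := hM (wordProd L ^ n)
  have h2 := reducedLength_eq S 1 (reduced_flatten_replicate hL n)
  rw [map_one, one_mul, ← (hpow n).1, (hpow n).2, wordNorm_one, zero_add] at h2
  rw [h2] at h
  rw [← mul_div_assoc, le_div_iff₀ (by exact_mod_cast hn), mul_comm]
  exact_mod_cast h

end Length

/-! ### Normal form of automorphisms and the finiteness argument -/

section Main

open scoped Pointwise

variable {Δ : Type*} [Group Δ]

theorem closure_image_inl_union {S : Set Δ} (hS : Subgroup.closure S = ⊤) :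
    Subgroup.closure ((inl : Δ →* Coprod Δ (Multiplicative ℤ)) '' S ∪ {stableLetter Δ}) = ⊤ := by
  rw [eq_top_iff]
  rintro γ -
  induction γ using coprod_induction with
  | inl a =>
    have : a ∈ Subgroup.closure S := hS ▸ Subgroup.mem_top a
    have := Subgroup.mem_map_of_mem (inl : Δ →* Coprod Δ (Multiplicative ℤ)) this
    rw [MonoidHom.map_closure] at this
    exact Subgroup.closure_mono Set.subset_union_left this
  | stableLetter => exact Subgroup.subset_closure (Or.inr rfl)
  | mul g g' hg hg' => exact mul_mem hg hg'
  | inv g hg => exact inv_mem hg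

/-- If `Δ` is co-Hopfian, then up to inner automorphisms every automorphism of `Δ * ℤ` preserves
`Δ` and maps `t` to an element represented by a nontrivial word starting with a power of `t`. -/
theorem exists_conj_normalForm
    (hΔ : ∀ θ : Δ →* Δ, Function.Injective θ → Function.Surjective θ)
    (ψ : MulAut (Coprod Δ (Multiplicative ℤ))) :
    ∃ (x : Coprod Δ (Multiplicative ℤ)) (α : Δ → Δ) (L : List (ℤˣ × Δ)) (v : ℤˣ) (d : Δ),
      Function.Injective α ∧ α 1 = 1 ∧ Reduced (L ++ [(v, d)]) ∧
      (∀ a, MulAut.conj x (ψ (inl a)) = inl (α a)) ∧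
      MulAut.conj x (ψ (stableLetter Δ)) = wordProd (L ++ [(v, d)]) := by
  obtain ⟨x, hx⟩ := exists_conj_range_le hΔ (ψ.toMonoidHom.comp inl)
    ((MulEquiv.injective ψ).comp inl_injective)
  choose α hα using hx
  have hα : ∀ a, MulAut.conj x (ψ (inl a)) = inl (α a) := hα
  let A : Δ →* Δ := MonoidHom.mk' α fun a b => inl_injective (N := Multiplicative ℤ) <| by
    rw [map_mul, ← hα, ← hα, ← hα, ← map_mul, ← map_mul, ← map_mul]
  have hA : Function.Injective A := by
    intro a b hab
    have : (inl (α a) : Coprod Δ (Multiplicative ℤ)) = inl (α b) := congrArg inl hab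
    rw [← hα, ← hα] at this
    exact inl_injective (ψ.injective ((MulAut.conj x).injective this))
  obtain ⟨a, L, hL, h⟩ := exists_reduced (MulAut.conj x (ψ (stableLetter Δ)))
  rcases List.eq_nil_or_concat' L with rfl | ⟨L, ⟨v, d⟩, rfl⟩
  -- If `ψ` sent `t` into the same conjugate of `Δ`, surjectivity of `α` (co-Hopficity) would place
  -- `t` itself in `Δ`.
  · exfalso
    obtain ⟨b, hb⟩ := hΔ A hA a
    have hb : α b = a := hb
    rw [wordProd_nil, mul_one, ← hb, ← hα] at h
    have h2 := ψ.injective ((MulAut.conj x).injective h)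
    have := reduced_unique (a := b) (a' := 1) (L := []) (L' := [(1, 1)]) List.isChain_nil
      (reduced_singleton _) (by simpa using h2.symm)
    simp at this
  · refine ⟨(inl a)⁻¹ * x, fun b => a⁻¹ * α b * a, L, v, d * a, fun b c hbc => ?_, ?_,
      (reduced_concat_iff _ _ _ _).1 hL, fun b => ?_, ?_⟩
    · exact hA (mul_left_cancel (mul_right_cancel hbc))
    · have : α 1 = 1 := map_one A
      simp [this]
    · rw [map_mul, MulAut.mul_apply, hα]
      simp
    · rw [map_mul, MulAut.mul_apply, h]
      simp [mul_assoc]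

/-- For trivial `Δ` the group is `ℤ`, and a sign change in a word is always a cancellation. -/
theorem Reduced.fst_eq_of_subsingleton [Subsingleton Δ] {p : ℤˣ × Δ} {L : List (ℤˣ × Δ)}
    (h : Reduced (p :: L)) : ∀ q ∈ p :: L, p.1 = q.1 := by
  induction L generalizing p with
  | nil => simp
  | cons r L ih =>
    have hr : p.1 = r.1 := (reduced_cons_cons.1 h).1 (Subsingleton.elim _ _)
    intro q hq
    rcases List.mem_cons.1 hq with rfl | hq
    · rfl
    · exact hr.trans (ih h.tail q hq)

theorem Reduced.append_self_of_subsingleton [Subsingleton Δ] {L : List (ℤˣ × Δ)}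
    (h : Reduced L) : Reduced (L ++ L) := by
  refine reduced_append.2 ⟨h, h, fun p hp q hq _ => ?_⟩
  rcases L with _ | ⟨r, L⟩
  · simp at hp
  · obtain rfl : r = q := by simpa using hq
    exact (h.fst_eq_of_subsingleton p (List.mem_of_getLast? hp)).symm

theorem Reduced.append_self_of_ne_one {L : List (ℤˣ × Δ)} {v : ℤˣ} {d : Δ}
    (h : Reduced (L ++ [(v, d)])) (hd : d ≠ 1) : Reduced (L ++ [(v, d)] ++ (L ++ [(v, d)])) := by
  refine reduced_append.2 ⟨h, h, fun p hp q _ hp1 => ?_⟩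
  obtain rfl : (v, d) = p := by simpa using hp
  exact absurd hp1 hd

theorem hasFSL_coprod_int (hfg : Group.FG Δ) (hcoHopf : IsCoHopfian Δ) :
    HasFSL (Coprod Δ (Multiplicative ℤ)) := by
  obtain ⟨S, hS⟩ := exists_isFiniteSymmGenSet hfg
  have hfin : ((inl : Δ →* Coprod Δ (Multiplicative ℤ)) '' S ∪ {stableLetter Δ}).Finite :=
    (hS.finite.image _).union (Set.finite_singleton _)
  have hclosure := closure_image_inl_union hS.closure_eq_top
  refine ⟨Group.fg_iff.2 ⟨_, hclosure, hfin⟩, fun T hT D hD => ?_⟩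
  obtain ⟨M, hM⟩ := exists_wordLength_le_mul_stableNorm hS hT
  -- A second test element besides `1`: as `α` is injective, `d * α 1` and `d * α g₁` cannot both be
  -- trivial.
  obtain ⟨g₁, hg₁⟩ : ∃ g₁ : Δ, g₁ ≠ 1 ∨ Subsingleton Δ := by
    rcases subsingleton_or_nontrivial Δ with h | h
    · exact ⟨1, Or.inr h⟩
    · exact (exists_ne 1).imp fun _ => Or.inl
  obtain ⟨R, hR⟩ : ∃ R : ℕ, ∀ g ∈ S ∪ {1, g₁},
      M * (D * wordNorm T (stableLetter Δ * inl g)) ≤ R := by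
    obtain ⟨r, hr⟩ := ((hS.finite.union (Set.toFinite {1, g₁})).image
      fun g => M * (D * wordNorm T (stableLetter Δ * inl g))).bddAbove
    obtain ⟨R, hR⟩ := exists_nat_ge r
    exact ⟨R, fun g hg => (hr ⟨g, hg, rfl⟩).trans hR⟩
  have hball := finite_wordNorm_le hS R
  set B := {g | wordNorm S g ≤ R} with hB
  -- Possible images of the generators: `α a = d⁻¹ * (d * α a)` lies in `B⁻¹ * B`, and the image of
  -- `t` has at most `R` letters from `L` and one final letter.
  let E : Set (Coprod Δ (Multiplicative ℤ)) := inl '' (B⁻¹ * B) ∪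
    wordProd '' {L | L.length ≤ R + 1 ∧ ∀ p ∈ L, p ∈ (Set.univ : Set ℤˣ) ×ˢ B}
  have hE : E.Finite := ((hball.inv.mul hball).image _).union
    ((finite_lists_of_length_le (Set.finite_univ.prod hball) _).image _)
  refine ((finite_mulAut_of_mem hfin hclosure hE).image
    (QuotientGroup.mk : MulAut (Coprod Δ (Multiplicative ℤ)) → Out _)).subset ?_
  rintro _ ⟨ψ, hψ, rfl⟩
  obtain ⟨x, α, L, v, d, hα, hα1, hL, hinl, ht⟩ := exists_conj_normalForm hcoHopf.surjective ψ
  refine ⟨MulAut.conj x * ψ, ?_, ?_⟩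
  swap
  · have hmem : MulAut.conj x ∈ Inn (Coprod Δ (Multiplicative ℤ)) := ⟨x, rfl⟩
    rw [QuotientGroup.mk_mul, (QuotientGroup.eq_one_iff _).2 hmem, one_mul]
  have hred : ∀ e, Reduced (L ++ [(v, e)]) := fun e => (reduced_concat_iff _ _ _ _).1 hL
  have hbound : ∀ g ∈ S ∪ {1, g₁}, Reduced (L ++ [(v, d * α g)] ++ (L ++ [(v, d * α g)])) →
      wordLength S (L ++ [(v, d * α g)]) ≤ R := by
    intro g hg hcyc
    have h1 : MulAut.conj x (ψ (stableLetter Δ * inl g)) = wordProd (L ++ [(v, d * α g)]) := by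
      rw [map_mul, map_mul, hinl, ht, wordProd_concat_mul]
    have h2 : stableNorm T (wordProd (L ++ [(v, d * α g)])) ≤
        D * wordNorm T (stableLetter Δ * inl g) := by
      rw [← h1]
      exact (stableNorm_conj_le hT _ _).trans ((hψ _).trans
        (mul_le_mul_of_nonneg_left (stableNorm_le_wordNorm hT _) (by linarith)))
    have h3 := (hM _ hcyc).trans ((mul_le_mul_of_nonneg_left h2 (Nat.cast_nonneg M)).trans (hR g hg))
    exact_mod_cast h3
  have hdα : ∀ g ∈ S ∪ {1, g₁}, d * α g ∈ B := by
    intro g hg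
    -- When `d * α g = 1` the stable norm gives no direct control, but then the word norm is zero.
    by_cases h1 : d * α g = 1
    · rw [h1, hB, Set.mem_ofPred_eq, wordNorm_one]
      exact Nat.zero_le _
    · exact (wordNorm_le_wordLength S (p := (v, d * α g)) (by simp)).trans
        (hbound g hg ((hred _).append_self_of_ne_one h1))
  have hdB : d ∈ B := by simpa [hα1] using hdα 1 (by simp)
  have hLR : wordLength S L ≤ R := by
    obtain ⟨g, hg, hcyc⟩ : ∃ g ∈ S ∪ {1, g₁},
        Reduced (L ++ [(v, d * α g)] ++ (L ++ [(v, d * α g)])) := by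
      by_cases h1 : d * α 1 = 1
      · rcases hg₁ with hg₁ | hsub
        · refine ⟨g₁, by simp, (hred _).append_self_of_ne_one fun h2 => hg₁ ?_⟩
          exact hα (mul_left_cancel (h2.trans h1.symm))
        · exact ⟨1, by simp, (hred _).append_self_of_subsingleton⟩
      · exact ⟨1, by simp, (hred _).append_self_of_ne_one h1⟩
    have := hbound g hg hcyc
    rw [wordLength_append] at this
    omega
  rintro s (⟨a, ha, rfl⟩ | rfl)
  · refine Or.inl ⟨α a, ⟨d⁻¹, Set.inv_mem_inv.2 hdB, d * α a, hdα a (Or.inl ha), ?_⟩, (hinl a).symm⟩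
    simp
  · refine Or.inr ⟨_, ⟨?_, fun p hp => ⟨Set.mem_univ _, ?_⟩⟩, ht.symm⟩
    · have := length_le_wordLength S L
      simp
      omega
    · rcases List.mem_append.1 hp with hp | hp
      · exact (wordNorm_le_wordLength S hp).trans hLR
      · obtain rfl : p = (v, d) := by simpa using hp
        exact hdB

end Main

end StableNorm

theorem mainTheorem10 {Δ : Type*} [Group Δ] (hfg : Group.FG Δ)
    (hcoHopf : StableNorm.IsCoHopfian Δ) (hfactor : ¬ StableNorm.HasFreeCyclicFactor Δ) :
    StableNorm.HasFSL (Monoid.Coprod Δ (Multiplicative ℤ)) := by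
  exact StableNorm.hasFSL_coprod_int hfg hcoHopf
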